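/- Fix two prototiles, rhombi $ABCD$ of side length $1$ with marked sides. The thick rhomb has angle $72^\circ$ at $A$ and $C$; it carries single arrows $A\to B$, $A\to D$ and double arrows $B\to C$, $D\to C$. The thin rhomb has angle $36^\circ$ at $A$ and $C$; it carries single arrows $A\to B$, $C\to B$ and double arrows $A\to D$, $C\to D$. A Penrose rhomb tiling is a tiling $\mathcal T$ of the plane by congruent copies of these two marked rhombi (the tiles cover the plane and have pairwise disjoint interiors) that is edge-to-edge (two distinct tiles are disjoint or meet exactly in a common corner or exactly in a common full side) and obeys the matching rule (on every common side of two tiles the two arrows agree in kind and direction). Its graph $G_{\mathcal T}$ has the corners of the tiles as vertices and the sides of the tiles as edges. Proposition (Penrose Rhomb). Let $\mathcal T$ be any Penrose rhomb tiling. Then $G_{\mathcal T}$ is locally finite, and giving weight $1$ to every edge with a double arrow and weight $3$ to every edge with a single arrow is a well-defined edge labelling $l\colon E(G_{\mathcal T})\to\{1,2,3\}$ which solves the 1-2-3 problem: with $s_l(u)=\sum_{uv\in E(G_{\mathcal T})} l(uv)$, one has $s_l(u)\neq s_l(v)$ for every edge $uv$ of $G_{\mathcal T}$. -/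

import Mathlib

/-! ## Edge labellings and the 1-2-3 problem -/

/-- The weighted degree `s_l(u) = ∑_{uv ∈ E} l(uv)` of a vertex of a locally finite graph. -/
noncomputable def weightedDegree {V : Type*} (G : SimpleGraph V) (l : G.edgeSet → ℕ) (u : V) : ℕ :=
  ∑ᶠ v : G.neighborSet u, l ⟨s(u, (v : V)), v.2⟩

/-- `l` is a solution of the 1-2-3 problem for `G`: the graph is locally finite, the labels are
in `{1, 2, 3}`, and adjacent vertices have different weighted degrees. -/
structure IsOneTwoThreeSolution {V : Type*} (G : SimpleGraph V) (l : G.edgeSet → ℕ) : Prop where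
  locallyFinite : ∀ u, (G.neighborSet u).Finite
  label_mem : ∀ e, l e ∈ ({1, 2, 3} : Set ℕ)
  colouring : ∀ u v, G.Adj u v → weightedDegree G l u ≠ weightedDegree G l v

/-! ## Penrose rhombs; the Euclidean plane is `ℂ` -/

/-- The two prototiles: the thick rhomb (angles 72° and 108°) and the thin rhomb (angles 36°
and 144°). -/
inductive RhombKind
  | thick
  | thin

/-- The angle of the prototile at its corners `A` and `C`. -/
noncomputable def RhombKind.angle : RhombKind → ℝ
  | .thick => 2 * Real.pi / 5
  | .thin => Real.pi / 5

/-- The two kinds of arrow on the sides of the rhombs. -/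
inductive ArrowKind
  | single
  | double

/-- A placed copy, of side length one, of one of the two prototiles: its corners in
counterclockwise order are `A, B, C, D`, where `A` is the point `base`, and `dir` is the unit vector
from `A` to `B`. Both prototiles are mirror symmetric together with their arrows (the thick one in
the diagonal `AC`, the thin one in the diagonal `BD`), so every image of a prototile under an
isometry of the plane, a reflection included, is represented, and only once. -/
structure RhombTile where
  kind : RhombKind
  base : ℂ
  dir : Circle

namespace RhombTile

/-- The unit vector from `A` to `D`. -/
noncomputable def dir' (T : RhombTile) : ℂ :=
  (T.dir : ℂ) * Complex.exp (T.kind.angle * Complex.I)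

/-- The corners `A, B, C, D`, in this order. -/
noncomputable def corner (T : RhombTile) : Fin 4 → ℂ :=
  ![T.base, T.base + T.dir, T.base + T.dir + T.dir', T.base + T.dir']

/-- The closed region that the tile occupies. -/
noncomputable def carrier (T : RhombTile) : Set ℂ :=
  convexHull ℝ (Set.range T.corner)

/-- `a` and `b` are the two endpoints of a side of the tile. -/
def IsSide (T : RhombTile) (a b : ℂ) : Prop :=
  ∃ i : Fin 4, (a = T.corner i ∧ b = T.corner (i + 1)) ∨ (b = T.corner i ∧ a = T.corner (i + 1))

/-- The arrows on the sides of a tile, as pairs (tail, head).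
Thick: single arrows `A → B`, `A → D` and double arrows `B → C`, `D → C`.
Thin: single arrows `A → B`, `C → B` and double arrows `A → D`, `C → D`. -/
def arrows (T : RhombTile) : ArrowKind → Set (ℂ × ℂ) :=
  match T.kind with
  | .thick => fun
    | .single => {(T.corner 0, T.corner 1), (T.corner 0, T.corner 3)}
    | .double => {(T.corner 1, T.corner 2), (T.corner 3, T.corner 2)}
  | .thin => fun
    | .single => {(T.corner 0, T.corner 1), (T.corner 2, T.corner 1)}
    | .double => {(T.corner 0, T.corner 3), (T.corner 2, T.corner 3)}

end RhombTile

/-- A Penrose rhomb tiling: an edge-to-edge tiling of the plane by thick and thin rhombs that obeys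
the arrow matching rule. -/
structure IsPenroseRhombTiling (𝒯 : Set RhombTile) : Prop where
  covers : ⋃ T ∈ 𝒯, T.carrier = Set.univ
  interiors_disjoint : ∀ S ∈ 𝒯, ∀ T ∈ 𝒯, S ≠ T →
    Disjoint (interior S.carrier) (interior T.carrier)
  /-- Distinct tiles are disjoint, or share just one corner, or share just one full side. -/
  edge_to_edge : ∀ S ∈ 𝒯, ∀ T ∈ 𝒯, S ≠ T →
    S.carrier ∩ T.carrier = ∅ ∨
    (∃ i j, S.corner i = T.corner j ∧ S.carrier ∩ T.carrier = {S.corner i}) ∨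
    (∃ a b, S.IsSide a b ∧ T.IsSide a b ∧ S.carrier ∩ T.carrier = segment ℝ a b)
  /-- On a common side the two tiles have the same kind of arrow with the same direction. -/
  matching : ∀ S ∈ 𝒯, ∀ T ∈ 𝒯, ∀ a b, S.IsSide a b → T.IsSide a b →
    ∀ k, (a, b) ∈ S.arrows k ↔ (a, b) ∈ T.arrows k

/-- The vertices of the tiling: all corners of its tiles. -/
def tilingVertices (𝒯 : Set RhombTile) : Set ℂ :=
  {v | ∃ T ∈ 𝒯, ∃ i, v = T.corner i}

/-- The graph of an edge-to-edge tiling: its vertices are the corners of the tiles, its edges the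
sides of the tiles. -/
def tilingGraph (𝒯 : Set RhombTile) : SimpleGraph (tilingVertices 𝒯) where
  Adj u v := u ≠ v ∧ ∃ T ∈ 𝒯, T.IsSide u v
  symm := ⟨by
    rintro u v ⟨hne, T, hT, i, h⟩
    exact ⟨hne.symm, T, hT, i, h.symm⟩⟩
  loopless := ⟨fun _ h => h.1 rfl⟩

/-- The edge `e` carries an arrow of kind `k`. -/
def CarriesArrow (𝒯 : Set RhombTile) (k : ArrowKind) (e : (tilingGraph 𝒯).edgeSet) : Prop :=
  ∃ T ∈ 𝒯, ∃ a b : tilingVertices 𝒯, ((a : ℂ), (b : ℂ)) ∈ T.arrows k ∧ (e : Sym2 _) = s(a, b)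

/-!
Give each edge end at a vertex one of four types: its arrow is single or double, and it leaves or
enters the vertex. Counterclockwise, the corners `A, B, C, D` of a thick rhomb lead from an edge
end to the next one as follows, with their angles in multiples of `π / 5`:
`A`: single out to single out (2), `B`: double out to single in (3),
`C`: double in to double in (2), `D`: single in to double out (3);
and those of a thin rhomb:
`A`: single out to double out (1), `B`: single in to single in (4),
`C`: double out to single out (1), `D`: double in to double in (4).
By the matching rule, the tiles round a vertex form a closed walk in this transition system with
total angle `10`, and the weighted degree is the total label of that walk
(`IsPenroseRhombTiling.sectorWalk_weightedDegree`). Running through the closed walks shows that the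
weighted degree of a vertex is

* at most `5` if a double arrow enters it, and at least `7` if one leaves it;
* at least `11` if a single arrow leaves it, and at most `12` if one enters it.

The first line settles the double edges. For a single edge from `u` to `v`, consider the two rhombs
that contain it. If one is thin, then `v` is its corner `B`, with angle `4`; the only closed walk
through such a corner has weight `7 < 11`. If both are thick, then `u` is the corner `A` of both,
and the closed walks with two consecutive corners of this type have weight at least `15 > 12`.

The geometric input is that tiles do close up round a vertex. The tiling is locally finite because
all tiles contain discs of a common radius, so the midpoint of a side, being a limit of points
outside its tile, lies in a second tile; as the tiling is edge-to-edge, that tile has the same side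
(`IsPenroseRhombTiling.exists_across`). Conversely, tiles whose angles at a vertex overlap are equal
(`IsPenroseRhombTiling.eq_of_overlap`). So the directions of the edges at a vertex differ by
multiples of `π / 5`, and the walk returns to its start after exactly one turn.
-/

open scoped Topology

/-! ### Corner types and edge ends -/

/-- The end of an edge at a vertex: the kind of arrow on the edge, and whether the arrow
leaves the vertex (`Out`) or enters it (`In`). -/
inductive EdgeEnd
  | singleOut
  | singleIn
  | doubleOut
  | doubleIn
  deriving DecidableEq

namespace EdgeEnd

/-- The opposite end of the same edge. -/
def reverse : EdgeEnd → EdgeEnd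
  | singleOut => singleIn
  | singleIn => singleOut
  | doubleOut => doubleIn
  | doubleIn => doubleOut

/-- The label of an edge with this end: `3` for a single and `1` for a double arrow. -/
def weight : EdgeEnd → ℕ
  | singleOut | singleIn => 3
  | doubleOut | doubleIn => 1

/-- The tail end of an edge with an arrow of the given kind. -/
def tail : ArrowKind → EdgeEnd
  | .single => singleOut
  | .double => doubleOut

@[simp] lemma reverse_reverse (a : EdgeEnd) : a.reverse.reverse = a := by cases a <;> rfl

end EdgeEnd

namespace RhombKind

/-- The end at corner `i` of the side from corner `i` to corner `i + 1`. -/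
def sideEnd : RhombKind → Fin 4 → EdgeEnd
  | thick => ![.singleOut, .doubleOut, .doubleIn, .singleIn]
  | thin => ![.singleOut, .singleIn, .doubleOut, .doubleIn]

/-- The end at corner `i` of the side from corner `i - 1`: this is where the angle at corner `i`,
crossed counterclockwise, leads from the end `sideEnd i`. -/
def nextEnd (κ : RhombKind) (i : Fin 4) : EdgeEnd := (κ.sideEnd (i + 3)).reverse

/-- The interior angle at corner `i`, in multiples of `π / 5`. -/
def span : RhombKind → Fin 4 → ℕ
  | thick => ![2, 3, 2, 3]
  | thin => ![1, 4, 1, 4]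

lemma span_pos (κ : RhombKind) (i : Fin 4) : 0 < κ.span i := by
  cases κ <;> fin_cases i <;> simp [span]

lemma span_lt (κ : RhombKind) (i : Fin 4) : κ.span i < 5 := by
  cases κ <;> fin_cases i <;> simp [span]

end RhombKind

/-! ### Rotations by multiples of `π / 5` -/

/-- The unit complex number `exp (iφ)`. -/
noncomputable def cis (φ : ℝ) : ℂ := Complex.exp (φ * Complex.I)

lemma cis_re (φ : ℝ) : (cis φ).re = Real.cos φ := Complex.exp_ofReal_mul_I_re φ

lemma cis_im (φ : ℝ) : (cis φ).im = Real.sin φ := Complex.exp_ofReal_mul_I_im φ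

lemma cis_add (φ ψ : ℝ) : cis (φ + ψ) = cis φ * cis ψ := by
  simp [cis, add_mul, Complex.exp_add]

@[simp] lemma norm_cis (φ : ℝ) : ‖cis φ‖ = 1 := Complex.norm_exp_ofReal_mul_I φ

@[simp] lemma cis_zero : cis 0 = 1 := by simp [cis]

lemma cis_pi : cis Real.pi = -1 := by simp [cis, Complex.exp_pi_mul_I]

lemma cis_eq_one {φ : ℝ} (h0 : 0 ≤ φ) (h1 : φ < 2 * Real.pi) (h : cis φ = 1) : φ = 0 := by
  have hc : Real.cos φ = 1 := by rw [← cis_re, h]; rfl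
  exact (Real.cos_eq_one_iff_of_lt_of_lt (by linarith [Real.pi_pos]) h1).1 hc

/-- The angle of `n` steps of `π / 5`. -/
noncomputable def stepAngle (n : ℕ) : ℝ := n * (Real.pi / 5)

@[simp] lemma stepAngle_zero : stepAngle 0 = 0 := by simp [stepAngle]

lemma stepAngle_add (m n : ℕ) : stepAngle (m + n) = stepAngle m + stepAngle n := by
  simp [stepAngle]; ring

lemma stepAngle_five : stepAngle 5 = Real.pi := by simp [stepAngle]; ring

lemma stepAngle_ten : stepAngle 10 = 2 * Real.pi := by simp [stepAngle]; ring

lemma stepAngle_lt {m n : ℕ} : stepAngle m < stepAngle n ↔ m < n := by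
  have : 0 < Real.pi / 5 := by positivity
  simp [stepAngle, this]

lemma stepAngle_le {m n : ℕ} : stepAngle m ≤ stepAngle n ↔ m ≤ n := by
  rw [← not_lt, stepAngle_lt, not_lt]

lemma stepAngle_nonneg (n : ℕ) : 0 ≤ stepAngle n := by unfold stepAngle; positivity

lemma cis_stepAngle_ten : cis (stepAngle 10) = 1 := by
  rw [stepAngle_ten, two_mul, cis_add, cis_pi]; simp

namespace RhombKind

lemma stepAngle_span_pos (κ : RhombKind) (i : Fin 4) : 0 < stepAngle (κ.span i) := by
  rw [← stepAngle_zero, stepAngle_lt]; exact κ.span_pos i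

lemma stepAngle_span_lt_pi (κ : RhombKind) (i : Fin 4) : stepAngle (κ.span i) < Real.pi := by
  rw [← stepAngle_five, stepAngle_lt]; exact κ.span_lt i

lemma sin_span_pos (κ : RhombKind) (i : Fin 4) : 0 < Real.sin (stepAngle (κ.span i)) :=
  Real.sin_pos_of_pos_of_lt_pi (κ.stepAngle_span_pos i) (κ.stepAngle_span_lt_pi i)

lemma angle_eq (κ : RhombKind) : κ.angle = stepAngle (κ.span 0) := by
  cases κ <;> simp [angle, span, stepAngle]
  ring

end RhombKind

/-! ### A single tile in the coordinates of one of its corners -/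

namespace RhombTile

variable (T : RhombTile) (i : Fin 4)

/-- The side of the tile from corner `i` to corner `i + 1`, as a vector. -/
noncomputable def side : ℂ := T.corner (i + 1) - T.corner i

/-- The rotation by the interior angle at corner `i`. -/
noncomputable def turn : ℂ := cis (stepAngle (T.kind.span i))

lemma turn_im : (T.turn i).im = Real.sin (stepAngle (T.kind.span i)) := cis_im _

lemma turn_im_pos : 0 < (T.turn i).im := by rw [turn_im]; exact T.kind.sin_span_pos i

lemma dir'_eq : T.dir' = T.dir * T.turn 0 := by
  rw [dir', turn, T.kind.angle_eq, cis]

/-- Consecutive interior angles of a rhomb add up to `π`. -/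
lemma turn_mul_turn : T.turn i * T.turn (i + 1) = -1 := by
  rw [turn, turn, ← cis_add, ← stepAngle_add, ← cis_pi, ← stepAngle_five]
  congr 2
  cases T.kind <;> fin_cases i <;> simp [RhombKind.span]

lemma corner_succ : T.corner (i + 1) = T.corner i + T.side i := by simp [side]

/-- Going round the tile, side `i` turns by the exterior angle at corner `i`. -/
lemma side_pred : T.side i * T.turn i = - T.side (i + 3) := by
  have h0 : T.turn 1 * T.turn 0 = -1 := by rw [mul_comm]; exact T.turn_mul_turn 0
  have h1 : T.turn 2 = T.turn 0 := by
    cases h : T.kind <;> simp [turn, h, RhombKind.span]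
  have h2 : T.turn 3 = T.turn 1 := by
    cases h : T.kind <;> simp [turn, h, RhombKind.span]
  have hd := T.dir'_eq
  fin_cases i <;> simp [side, corner, h1, h2, hd]
  · linear_combination (T.dir : ℂ) * h0
  · linear_combination (-(T.dir : ℂ)) * h0

lemma corner_pred : T.corner (i + 3) = T.corner i + T.side i * T.turn i := by
  rw [side_pred, side]
  have : i + 3 + 1 = i := by fin_cases i <;> rfl
  rw [this]; ring

lemma corner_opp : T.corner (i + 2) = T.corner i + T.side i + T.side i * T.turn i := by
  have h := T.corner_pred i
  fin_cases i <;> simp [side, corner] at h ⊢ <;> linear_combination h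

lemma norm_side : ‖T.side i‖ = 1 := by
  have h0 : ‖(T.dir : ℂ)‖ = 1 := Circle.norm_coe T.dir
  have h1 : ‖T.dir'‖ = 1 := by rw [dir'_eq, turn, norm_mul, h0, norm_cis, one_mul]
  fin_cases i
  · simpa [side, corner] using h0
  · simp [side, corner, h1]
  · have : T.side 2 = - T.dir := by simp [side, corner]
    simpa [this] using h0
  · simp [side, corner, h1]

lemma side_ne_zero : T.side i ≠ 0 := by
  intro h; have := T.norm_side i; simp [h] at this

/-- The point with coordinates `s, t` in the frame at corner `i` spanned by the two sides there. -/
noncomputable def point (s t : ℝ) : ℂ := T.corner i + T.side i * (s + t * T.turn i)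

/-- The coordinate along the side from corner `i` to corner `i + 3`. -/
noncomputable def coordT (z : ℂ) : ℝ := ((z - T.corner i) / T.side i).im / (T.turn i).im

/-- The coordinate along the side from corner `i` to corner `i + 1`. -/
noncomputable def coordS (z : ℂ) : ℝ :=
  ((z - T.corner i) / T.side i).re - T.coordT i z * (T.turn i).re

@[simp] lemma coordT_point (s t : ℝ) : T.coordT i (T.point i s t) = t := by
  have h := T.side_ne_zero i
  have h' := (T.turn_im_pos i).ne'
  simp [coordT, point, mul_div_cancel_left₀ _ h, h']

@[simp] lemma coordS_point (s t : ℝ) : T.coordS i (T.point i s t) = s := by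
  have h := T.side_ne_zero i
  rw [coordS, coordT_point]
  simp [point, mul_div_cancel_left₀ _ h]

lemma point_coord (z : ℂ) : T.point i (T.coordS i z) (T.coordT i z) = z := by
  have h := T.side_ne_zero i
  have h' := (T.turn_im_pos i).ne'
  have : ((T.coordS i z : ℂ) + T.coordT i z * T.turn i) = (z - T.corner i) / T.side i := by
    apply Complex.ext
    · simp [coordS]
    · simp [coordT, h']
  rw [point, this, mul_div_cancel₀ _ h]; ring

lemma corner_eq_point₀ : T.corner i = T.point i 0 0 := by simp [point]
lemma corner_eq_point₁ : T.corner (i + 1) = T.point i 1 0 := by simp [point, corner_succ]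
lemma corner_eq_point₂ : T.corner (i + 2) = T.point i 1 1 := by simp [point, corner_opp]; ring
lemma corner_eq_point₃ : T.corner (i + 3) = T.point i 0 1 := by simp [point, corner_pred]

lemma continuous_coordT : Continuous (T.coordT i) := by unfold coordT; fun_prop
lemma continuous_coordS : Continuous (T.coordS i) := by
  have := T.continuous_coordT i
  unfold coordS; fun_prop

lemma range_corner : Set.range T.corner =
    {T.point i 0 0, T.point i 1 0, T.point i 1 1, T.point i 0 1} := by
  rw [← corner_eq_point₀, ← corner_eq_point₁, ← corner_eq_point₂, ← corner_eq_point₃]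
  ext z
  simp only [Set.mem_range, Set.mem_insert_iff, Set.mem_singleton_iff]
  constructor
  · rintro ⟨j, rfl⟩
    have : j = i ∨ j = i + 1 ∨ j = i + 2 ∨ j = i + 3 := by omega
    rcases this with rfl | rfl | rfl | rfl <;> simp
  · rintro (rfl | rfl | rfl | rfl) <;> exact ⟨_, rfl⟩

/-- The tile is the unit square in the coordinates of any of its corners. -/
lemma mem_carrier_iff (z : ℂ) : z ∈ T.carrier ↔
    (0 ≤ T.coordS i z ∧ T.coordS i z ≤ 1) ∧ (0 ≤ T.coordT i z ∧ T.coordT i z ≤ 1) := by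
  have hlin : ∀ (p q : ℂ) (a b : ℝ), a + b = 1 →
      T.coordT i (a • p + b • q) = a * T.coordT i p + b * T.coordT i q ∧
      T.coordS i (a • p + b • q) = a * T.coordS i p + b * T.coordS i q := by
    intro p q a b hab
    have : (a • p + b • q) = T.point i (a * T.coordS i p + b * T.coordS i q)
        (a * T.coordT i p + b * T.coordT i q) := by
      conv_lhs => rw [← T.point_coord i p, ← T.point_coord i q]
      simp only [point, Complex.real_smul]
      have hab' : (a : ℂ) + b = 1 := by exact_mod_cast hab
      push_cast
      linear_combination T.corner i * hab'
    rw [this]; simp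
  constructor
  · intro hz
    have hconv : Convex ℝ {z | (0 ≤ T.coordS i z ∧ T.coordS i z ≤ 1) ∧
        (0 ≤ T.coordT i z ∧ T.coordT i z ≤ 1)} := by
      rintro p ⟨⟨h1, h2⟩, h3, h4⟩ q ⟨⟨h5, h6⟩, h7, h8⟩ a b ha hb hab
      obtain ⟨e1, e2⟩ := hlin p q a b hab
      simp only [Set.mem_ofPred_eq, e1, e2]
      refine ⟨⟨by positivity, ?_⟩, by positivity, ?_⟩ <;> nlinarith
    refine convexHull_min ?_ hconv hz
    rw [T.range_corner i]
    rintro w (rfl | rfl | rfl | rfl) <;> simp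
  · rintro ⟨⟨h1, h2⟩, h3, h4⟩
    set s := T.coordS i z with hs
    set t := T.coordT i z with ht
    have hc : Convex ℝ T.carrier := convex_convexHull ℝ _
    have hm : ∀ w ∈ ({T.point i 0 0, T.point i 1 0, T.point i 1 1, T.point i 0 1} : Set ℂ),
        w ∈ T.carrier := by
      rw [← T.range_corner i]; exact fun w hw => subset_convexHull ℝ _ hw
    have e : ∀ t : ℝ, ((1 - t : ℝ) + (t : ℝ) : ℝ) = 1 := fun t => by ring
    have m0 := hc (hm (T.point i 0 0) (by simp)) (hm (T.point i 1 0) (by simp))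
      (sub_nonneg.2 h2) h1 (e s)
    have m1 := hc (hm (T.point i 0 1) (by simp)) (hm (T.point i 1 1) (by simp))
      (sub_nonneg.2 h2) h1 (e s)
    have m2 := hc m0 m1 (sub_nonneg.2 h4) h3 (e t)
    convert m2 using 1
    rw [← T.point_coord i z, ← hs, ← ht]
    simp only [point, Complex.real_smul]
    push_cast
    ring

lemma point_mem_interior {s t : ℝ} (hs : 0 < s) (hs' : s < 1) (ht : 0 < t) (ht' : t < 1) :
    T.point i s t ∈ interior T.carrier := by
  have ho : IsOpen {z | (0 < T.coordS i z ∧ T.coordS i z < 1) ∧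
      (0 < T.coordT i z ∧ T.coordT i z < 1)} := by
    have h1 := T.continuous_coordS i
    have h2 := T.continuous_coordT i
    exact ((isOpen_lt continuous_const h1).inter (isOpen_lt h1 continuous_const)).inter
      ((isOpen_lt continuous_const h2).inter (isOpen_lt h2 continuous_const))
  refine interior_maximal ?_ ho (by simp [*])
  rintro z ⟨⟨h1, h2⟩, h3, h4⟩
  exact (T.mem_carrier_iff i z).2 ⟨⟨h1.le, h2.le⟩, h3.le, h4.le⟩

lemma isClosed_carrier : IsClosed T.carrier :=
  ((Set.finite_range T.corner).isCompact_convexHull (𝕜 := ℝ)).isClosed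

lemma corner_injective : Function.Injective T.corner := by
  have key : ∀ i, T.corner i ≠ T.corner (i + 1) ∧ T.corner i ≠ T.corner (i + 2) ∧
      T.corner i ≠ T.corner (i + 3) := by
    intro i
    refine ⟨fun h => ?_, fun h => ?_, fun h => ?_⟩
    · rw [corner_eq_point₀, corner_eq_point₁] at h
      simpa using congrArg (T.coordS i) h
    · rw [corner_eq_point₀, corner_eq_point₂] at h
      simpa using congrArg (T.coordS i) h
    · rw [corner_eq_point₀, corner_eq_point₃] at h
      simpa using congrArg (T.coordT i) h
  intro i j h
  obtain ⟨h1, h2, h3⟩ := key i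
  have : j = i ∨ j = i + 1 ∨ j = i + 2 ∨ j = i + 3 := by
    omega
  rcases this with rfl | rfl | rfl | rfl
  · rfl
  · exact absurd h h1
  · exact absurd h h2
  · exact absurd h h3

/-- Directions inside the angle at corner `i` point into the interior of the tile. -/
lemma exists_forall_ray_mem_interior {ψ : ℝ} (h0 : 0 < ψ)
    (h1 : ψ < stepAngle (T.kind.span i)) :
    ∃ ε > (0 : ℝ), ∀ r : ℝ, 0 < r → r < ε →
      T.corner i + T.side i * (r * cis ψ) ∈ interior T.carrier := by
  set α := stepAngle (T.kind.span i) with hα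
  have hα' : α < Real.pi := T.kind.stepAngle_span_lt_pi i
  have hsα : 0 < Real.sin α := T.kind.sin_span_pos i
  have hs : 0 < Real.sin (α - ψ) := Real.sin_pos_of_pos_of_lt_pi (by linarith) (by linarith)
  have ht : 0 < Real.sin ψ := Real.sin_pos_of_pos_of_lt_pi h0 (by linarith)
  have hcis : cis ψ = (Real.sin (α - ψ) / Real.sin α : ℝ) + (Real.sin ψ / Real.sin α : ℝ) *
      T.turn i := by
    apply Complex.ext
    · rw [Complex.add_re, Complex.re_ofReal_mul, Complex.ofReal_re, turn, cis_re, cis_re,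
        Real.sin_sub, ← hα]
      field_simp; ring
    · rw [Complex.add_im, Complex.im_ofReal_mul, Complex.ofReal_im, turn, cis_im, cis_im, ← hα]
      field_simp; ring
  refine ⟨Real.sin α, hsα, fun r hr hr' => ?_⟩
  have : T.corner i + T.side i * (r * cis ψ) =
      T.point i (r * (Real.sin (α - ψ) / Real.sin α)) (r * (Real.sin ψ / Real.sin α)) := by
    rw [hcis, point]; push_cast; ring
  rw [this]
  have aux : ∀ x : ℝ, r * (Real.sin x / Real.sin α) < 1 := by
    intro x
    rw [← mul_div_assoc, div_lt_one hsα]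
    nlinarith [Real.sin_le_one x]
  exact T.point_mem_interior i (by positivity) (aux _) (by positivity) (aux _)

/-- The midpoint of a side lies on no other side of the tile. -/
lemma eq_of_midpoint_mem_segment {j : Fin 4}
    (h : T.point i (1 / 2) 0 ∈ segment ℝ (T.corner j) (T.corner (j + 1))) : j = i := by
  obtain ⟨a, b, ha, hb, hab, h⟩ := h
  have hab' : (a : ℂ) = 1 - b := by exact_mod_cast (eq_sub_of_add_eq hab)
  have hj : j = i ∨ j = i + 1 ∨ j = i + 2 ∨ j = i + 3 := by
    omega
  rcases hj with rfl | rfl | rfl | rfl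
  · rfl
  · have e : T.point i (1 / 2) 0 = T.point i 1 b := by
      rw [← h, show i + 1 + 1 = i + 2 by omega, corner_eq_point₁, corner_eq_point₂]
      simp only [point, Complex.real_smul, hab']; push_cast; ring
    have := congrArg (T.coordS i) e
    norm_num at this
  · have e : T.point i (1 / 2) 0 = T.point i a 1 := by
      rw [← h, show i + 2 + 1 = i + 3 by omega, corner_eq_point₂, corner_eq_point₃]
      simp only [point, Complex.real_smul, hab']; push_cast; ring
    have := congrArg (T.coordT i) e
    norm_num at this
  · have e : T.point i (1 / 2) 0 = T.point i 0 a := by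
      rw [← h, show i + 3 + 1 = i by omega, corner_eq_point₃]
      simp only [point, Complex.real_smul, hab']; push_cast; ring
    have := congrArg (T.coordS i) e
    norm_num at this

lemma midpoint_ne_corner (j : Fin 4) : T.point i (1 / 2) 0 ≠ T.corner j := by
  intro h
  have h1 : j = i := T.eq_of_midpoint_mem_segment i (h ▸ left_mem_segment ℝ _ _)
  rw [h1, corner_eq_point₀] at h
  have := congrArg (T.coordS i) h
  norm_num at this

/-- The centre of the tile. -/
noncomputable def centre : ℂ := T.point 0 (1 / 2) (1 / 2)

lemma centre_mem_interior : T.centre ∈ interior T.carrier :=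
  T.point_mem_interior 0 (by norm_num) (by norm_num) (by norm_num) (by norm_num)

/-- A tile contains a disc whose radius does not depend on the tile. -/
lemma ball_subset_interior : Metric.ball T.centre (Real.sin (Real.pi / 5) / 4) ⊆
    interior T.carrier := by
  intro z hz
  have hσ : 0 < Real.sin (Real.pi / 5) :=
    Real.sin_pos_of_pos_of_lt_pi (by positivity) (by linarith [Real.pi_pos])
  have hc : Real.sin (Real.pi / 5) ≤ (T.turn 0).im := by
    rw [turn_im]
    cases T.kind
    · simp only [RhombKind.span, stepAngle, Matrix.cons_val_zero]
      apply Real.sin_le_sin_of_le_of_le_pi_div_two <;> push_cast <;> linarith [Real.pi_pos]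
    · simp [RhombKind.span, stepAngle]
  set w := (z - T.centre) / T.side 0 with hw
  have hwn : ‖w‖ < Real.sin (Real.pi / 5) / 4 := by
    rw [hw, norm_div, norm_side, div_one, ← dist_eq_norm]; exact hz
  have hre := Complex.abs_re_le_norm w
  have him := Complex.abs_im_le_norm w
  have hpos := T.turn_im_pos 0
  set q := w.im / (T.turn 0).im with hq
  have hqabs : |q| < 1 / 4 := by
    rw [hq, abs_div, abs_of_pos hpos, div_lt_iff₀ hpos]; linarith
  have hcre : |(T.turn 0).re| ≤ 1 := by
    have := Complex.abs_re_le_norm (T.turn 0)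
    rwa [turn, norm_cis] at this
  have hqre : |q * (T.turn 0).re| ≤ |q| := by
    rw [abs_mul]; exact mul_le_of_le_one_right (abs_nonneg _) hcre
  have hz' : z = T.point 0 (1 / 2 + (w.re - q * (T.turn 0).re)) (1 / 2 + q) := by
    have h1 : w = ((w.re - q * (T.turn 0).re : ℝ) : ℂ) + (q : ℝ) * T.turn 0 := by
      apply Complex.ext
      · simp
      · simp [hq, hpos.ne']
    have h2 : z = T.centre + T.side 0 * w := by
      rw [hw, mul_div_cancel₀ _ (T.side_ne_zero 0)]; ring
    rw [h2]
    conv_lhs => rw [h1]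
    rw [centre, point, point]; push_cast; ring
  have hs1 := Real.sin_le_one (Real.pi / 5)
  rw [hz']
  rw [abs_lt] at hqabs
  have h3 := abs_le.1 (hre.trans hwn.le)
  have h4 := abs_lt.1 (hqre.trans_lt (abs_lt.2 hqabs))
  apply T.point_mem_interior <;> linarith [h3.1, h3.2, h4.1, h4.2, hqabs.1, hqabs.2]

lemma dist_centre_le {z : ℂ} (hz : z ∈ T.carrier) : dist z T.centre ≤ 1 := by
  obtain ⟨⟨h1, h2⟩, h3, h4⟩ := (T.mem_carrier_iff 0 z).1 hz
  rw [← T.point_coord 0 z, dist_eq_norm]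
  set s := T.coordS 0 z
  set t := T.coordT 0 z
  have : T.point 0 s t - T.centre = T.side 0 * ((s - 1 / 2 : ℝ) + (t - 1 / 2 : ℝ) * T.turn 0) := by
    rw [centre, point, point]; push_cast; ring
  rw [this, norm_mul, norm_side, one_mul]
  refine (norm_add_le _ _).trans ?_
  rw [norm_mul, turn, norm_cis, Complex.norm_real, Complex.norm_real, mul_one,
    Real.norm_eq_abs, Real.norm_eq_abs]
  have : |s - 1 / 2| ≤ 1 / 2 := abs_le.2 ⟨by linarith, by linarith⟩
  have : |t - 1 / 2| ≤ 1 / 2 := abs_le.2 ⟨by linarith, by linarith⟩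
  linarith

/-- The arrows of a tile, read off from the ends of its sides. -/
lemma mem_arrows_side_iff (k : ArrowKind) :
    (T.corner i, T.corner (i + 1)) ∈ T.arrows k ↔ T.kind.sideEnd i = EdgeEnd.tail k := by
  have h := T.corner_injective
  rcases T with ⟨κ, b, d⟩
  cases κ <;> cases k <;> fin_cases i <;>
    simp [arrows, RhombKind.sideEnd, EdgeEnd.tail, h.eq_iff, -Fin.reduceEq] <;> decide

lemma mem_arrows_reversed_side_iff (k : ArrowKind) :
    (T.corner (i + 1), T.corner i) ∈ T.arrows k ↔
      (T.kind.sideEnd i).reverse = EdgeEnd.tail k := by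
  have h := T.corner_injective
  rcases T with ⟨κ, b, d⟩
  cases κ <;> cases k <;> fin_cases i <;>
    simp [arrows, RhombKind.sideEnd, EdgeEnd.tail, EdgeEnd.reverse, h.eq_iff, -Fin.reduceEq] <;>
    decide

lemma isSide_of_mem_arrows {k : ArrowKind} {a b : ℂ} (h : (a, b) ∈ T.arrows k) :
    T.IsSide a b := by
  rcases T with ⟨κ, p, d⟩
  cases κ <;> cases k <;> simp only [arrows, Set.mem_insert_iff, Set.mem_singleton_iff,
    Prod.mk.injEq] at h <;> rcases h with ⟨rfl, rfl⟩ | ⟨rfl, rfl⟩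
  · exact ⟨0, .inl ⟨rfl, rfl⟩⟩
  · exact ⟨3, .inr ⟨rfl, rfl⟩⟩
  · exact ⟨1, .inl ⟨rfl, rfl⟩⟩
  · exact ⟨2, .inr ⟨rfl, rfl⟩⟩
  · exact ⟨0, .inl ⟨rfl, rfl⟩⟩
  · exact ⟨1, .inr ⟨rfl, rfl⟩⟩
  · exact ⟨3, .inr ⟨rfl, rfl⟩⟩
  · exact ⟨2, .inl ⟨rfl, rfl⟩⟩

end RhombTile

/-! ### Neighbouring tiles -/

namespace IsPenroseRhombTiling

variable {𝒯 : Set RhombTile} (h𝒯 : IsPenroseRhombTiling 𝒯)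
include h𝒯

lemma eq_of_mem_interior {S T : RhombTile} (hS : S ∈ 𝒯) (hT : T ∈ 𝒯) {z : ℂ}
    (hzS : z ∈ interior S.carrier) (hzT : z ∈ interior T.carrier) : S = T := by
  by_contra hne
  exact Set.disjoint_left.1 (h𝒯.interiors_disjoint S hS T hT hne) hzS hzT

/-- Two tiles whose angles at a common corner overlap are equal. -/
lemma eq_of_overlap {S T : RhombTile} (hS : S ∈ 𝒯) (hT : T ∈ 𝒯) {i j : Fin 4}
    (hc : T.corner j = S.corner i) {φ : ℝ} (hd : T.side j = S.side i * cis φ)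
    (h0 : 0 ≤ φ) (h1 : φ < stepAngle (S.kind.span i)) : S = T ∧ i = j ∧ φ = 0 := by
  obtain ⟨ψ, hψ0, hψ⟩ := exists_between
    (lt_min (sub_pos.2 h1) (T.kind.stepAngle_span_pos j))
  obtain ⟨hψ1, hψ2⟩ := lt_min_iff.1 hψ
  obtain ⟨ε, hε, hεS⟩ := S.exists_forall_ray_mem_interior i (ψ := φ + ψ) (by linarith)
    (by linarith)
  obtain ⟨δ, hδ, hδT⟩ := T.exists_forall_ray_mem_interior j hψ0 hψ2
  obtain ⟨r, hr, hrr⟩ := exists_between (lt_min hε hδ)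
  obtain ⟨hr1, hr2⟩ := lt_min_iff.1 hrr
  have e : T.corner j + T.side j * (r * cis ψ) = S.corner i + S.side i * (r * cis (φ + ψ)) := by
    rw [hc, hd, cis_add]; ring
  obtain rfl : S = T := h𝒯.eq_of_mem_interior hS hT (hεS r hr hr1) (e ▸ hδT r hr hr2)
  obtain rfl : j = i := S.corner_injective hc
  refine ⟨rfl, rfl, cis_eq_one h0 ?_ ?_⟩
  · linarith [S.kind.stepAngle_span_lt_pi j, Real.pi_pos]
  · have := S.side_ne_zero j
    exact (mul_left_cancel₀ this (by rw [mul_one]; exact hd)).symm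

/-- Only finitely many tiles come near a given point: every tile contains a disc of a fixed
radius, and these discs are disjoint. -/
lemma finite_near (x : ℂ) : {T ∈ 𝒯 | (T.carrier ∩ Metric.closedBall x 1).Nonempty}.Finite := by
  set F := {T ∈ 𝒯 | (T.carrier ∩ Metric.closedBall x 1).Nonempty}
  have hρ : 0 < Real.sin (Real.pi / 5) / 4 :=
    div_pos (Real.sin_pos_of_pos_of_lt_pi (by positivity) (by linarith [Real.pi_pos])) (by norm_num)
  set ρ := Real.sin (Real.pi / 5) / 4
  have hsep : ∀ S ∈ 𝒯, ∀ T ∈ 𝒯, dist S.centre T.centre < ρ → S = T := fun S hS T hT h =>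
    h𝒯.eq_of_mem_interior hS hT S.centre_mem_interior (T.ball_subset_interior h)
  have hinj : Set.InjOn RhombTile.centre F := fun S hS T hT h =>
    hsep S hS.1 T hT.1 (by rw [h, dist_self]; exact hρ)
  refine Set.Finite.of_finite_image ?_ hinj
  by_contra hinf
  have hsub : RhombTile.centre '' F ⊆ Metric.closedBall x 2 := by
    rintro _ ⟨T, ⟨-, z, hz, hzx⟩, rfl⟩
    rw [Metric.mem_closedBall] at hzx ⊢
    linarith [dist_triangle_left T.centre x z, T.dist_centre_le hz]
  obtain ⟨y, -, hy⟩ := Set.Infinite.exists_accPt_of_subset_isCompact hinf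
    (isCompact_closedBall x 2) hsub
  rw [accPt_iff_nhds] at hy
  obtain ⟨_, ⟨hp1, S, hS, rfl⟩, hp2⟩ := hy _ (Metric.ball_mem_nhds y (half_pos hρ))
  obtain ⟨_, ⟨hq1, T, hT, rfl⟩, hq2⟩ := hy _ (Metric.ball_mem_nhds y (dist_pos.2 hp2))
  rw [Metric.mem_ball] at hp1 hq1
  have : S = T := hsep S hS.1 T hT.1 (by linarith [dist_triangle_right S.centre T.centre y])
  rw [this] at hq1
  exact lt_irrefl _ hq1

/-- Every side of a tile is a side of a second tile, which lies on the other side of it. -/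
lemma exists_across {T : RhombTile} (hT : T ∈ 𝒯) (i : Fin 4) :
    ∃ S ∈ 𝒯, ∃ j, S.corner j = T.corner (i + 1) ∧ S.corner (j + 1) = T.corner i := by
  set m := T.point i (1 / 2) 0
  set F := {S ∈ 𝒯 | (S.carrier ∩ Metric.closedBall m 1).Nonempty} \ {T}
  have hF : F.Finite := (h𝒯.finite_near m).subset Set.sdiff_subset
  have hclosed : IsClosed (⋃ S ∈ F, S.carrier) := hF.isClosed_biUnion fun S _ => S.isClosed_carrier
  -- The midpoint of the side is a limit of points outside `T`, hence lies in another tile.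
  have hlim : Filter.Tendsto (fun n : ℕ => T.point i (1 / 2) (-(1 / ((n : ℝ) + 1))))
      Filter.atTop (𝓝 m) := by
    have h1 : Filter.Tendsto (fun n : ℕ => -(1 / ((n : ℝ) + 1))) Filter.atTop (𝓝 (-0)) :=
      tendsto_one_div_add_atTop_nhds_zero_nat.neg
    rw [neg_zero] at h1
    have h2 : Continuous (fun t : ℝ => T.point i (1 / 2) t) := by
      unfold RhombTile.point; fun_prop
    exact (h2.tendsto 0).comp h1
  have hev : ∀ᶠ n : ℕ in Filter.atTop,
      T.point i (1 / 2) (-(1 / ((n : ℝ) + 1))) ∈ ⋃ S ∈ F, S.carrier := by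
    filter_upwards [hlim.eventually (Metric.closedBall_mem_nhds m one_pos)] with n hn
    have hcov := h𝒯.covers.ge (Set.mem_univ (T.point i (1 / 2) (-(1 / ((n : ℝ) + 1)))))
    simp only [Set.mem_iUnion] at hcov ⊢
    obtain ⟨S, hS, hz⟩ := hcov
    refine ⟨S, ⟨⟨hS, _, hz, hn⟩, ?_⟩, hz⟩
    rintro rfl
    have h3 := ((S.mem_carrier_iff i _).1 hz).2.1
    rw [RhombTile.coordT_point] at h3
    have : (0 : ℝ) < 1 / ((n : ℝ) + 1) := by positivity
    linarith
  have hm := hclosed.mem_of_tendsto hlim hev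
  simp only [Set.mem_iUnion] at hm
  obtain ⟨S, ⟨⟨hS, -⟩, hne⟩, hmS⟩ := hm
  have hmT : m ∈ T.carrier := by rw [T.mem_carrier_iff i]; simp [m]; norm_num
  have hmem : m ∈ T.carrier ∩ S.carrier := ⟨hmT, hmS⟩
  have hne' : T ≠ S := fun h => hne h.symm
  rcases h𝒯.edge_to_edge T hT S hS hne' with h | ⟨j, k, -, h⟩ | ⟨a, b, hab, ⟨j, hj⟩, h⟩
  · rw [h] at hmem; exact hmem.elim
  · rw [h] at hmem; exact (T.midpoint_ne_corner i j hmem).elim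
  rw [h] at hmem
  have hab' : (a = T.corner i ∧ b = T.corner (i + 1)) ∨
      (b = T.corner i ∧ a = T.corner (i + 1)) := by
    obtain ⟨k, ⟨rfl, rfl⟩ | ⟨rfl, rfl⟩⟩ := hab
    · obtain rfl := T.eq_of_midpoint_mem_segment i hmem
      exact .inl ⟨rfl, rfl⟩
    · rw [segment_symm] at hmem
      obtain rfl := T.eq_of_midpoint_mem_segment i hmem
      exact .inr ⟨rfl, rfl⟩
  -- A second tile on the same side of the segment would overlap `T`.
  have hover : ¬ (S.corner j = T.corner i ∧ S.corner (j + 1) = T.corner (i + 1)) := by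
    rintro ⟨h1, h2⟩
    refine hne' (h𝒯.eq_of_overlap hT hS h1 (φ := 0) ?_ le_rfl (T.kind.stepAngle_span_pos i)).1
    rw [RhombTile.side, RhombTile.side, h1, h2, cis_zero, mul_one]
  refine ⟨S, hS, j, ?_⟩
  rcases hab' with ⟨ha, hb⟩ | ⟨ha, hb⟩ <;> rcases hj with ⟨hc, hd⟩ | ⟨hc, hd⟩ <;>
    rw [ha] at * <;> rw [hb] at *
  · exact (hover ⟨hc.symm, hd.symm⟩).elim
  · exact ⟨hc.symm, hd.symm⟩
  · exact ⟨hc.symm, hd.symm⟩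
  · exact (hover ⟨hc.symm, hd.symm⟩).elim

/-- The matching rule: on a common side of two tiles the two ends are opposite. -/
lemma sideEnd_across {S T : RhombTile} (hS : S ∈ 𝒯) (hT : T ∈ 𝒯) {i j : Fin 4}
    (h1 : S.corner j = T.corner (i + 1)) (h2 : S.corner (j + 1) = T.corner i) :
    S.kind.sideEnd j = (T.kind.sideEnd i).reverse := by
  have hmS : ∀ a b k, S.IsSide a b → T.IsSide a b → ((a, b) ∈ S.arrows k ↔ (a, b) ∈ T.arrows k) :=
    fun a b k ha hb => h𝒯.matching S hS T hT a b ha hb k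
  have key : ∀ k, (S.kind.sideEnd j = EdgeEnd.tail k ↔
      (T.kind.sideEnd i).reverse = EdgeEnd.tail k) := by
    intro k
    rw [← S.mem_arrows_side_iff, ← T.mem_arrows_reversed_side_iff, ← h1, ← h2]
    exact hmS _ _ _ ⟨j, .inl ⟨rfl, rfl⟩⟩ ⟨i, .inr ⟨h2, h1⟩⟩
  have key' : ∀ k, ((S.kind.sideEnd j).reverse = EdgeEnd.tail k ↔
      T.kind.sideEnd i = EdgeEnd.tail k) := by
    intro k
    rw [← S.mem_arrows_reversed_side_iff, ← T.mem_arrows_side_iff, ← h1, ← h2]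
    exact hmS _ _ _ ⟨j, .inr ⟨rfl, rfl⟩⟩ ⟨i, .inl ⟨h2, h1⟩⟩
  have a1 := key .single
  have a2 := key .double
  have a3 := key' .single
  have a4 := key' .double
  revert a1 a2 a3 a4
  cases S.kind.sideEnd j <;> cases T.kind.sideEnd i <;>
    simp [EdgeEnd.tail, EdgeEnd.reverse]

end IsPenroseRhombTiling

/-! ### The tiles round a vertex -/

/-- Some tile has `u` as its corner `i` and the edge in direction `d` as its first side there,
counterclockwise; the tile is of kind `κ`. -/
def HasSector (𝒯 : Set RhombTile) (u d : ℂ) (κ : RhombKind) (i : Fin 4) : Prop :=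
  ∃ T ∈ 𝒯, T.kind = κ ∧ T.corner i = u ∧ T.side i = d

/-- The tiling has an edge at `u` in direction `d`, and its end at `u` is `a`. -/
def HasEdge (𝒯 : Set RhombTile) (u d : ℂ) (a : EdgeEnd) : Prop :=
  ∃ κ i, HasSector 𝒯 u d κ i ∧ κ.sideEnd i = a

namespace IsPenroseRhombTiling

variable {𝒯 : Set RhombTile} (h𝒯 : IsPenroseRhombTiling 𝒯)
include h𝒯

/-- The edge where a sector ends. -/
lemma hasEdge_end {u d : ℂ} {κ : RhombKind} {i : Fin 4} (h : HasSector 𝒯 u d κ i) :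
    HasEdge 𝒯 u (d * cis (stepAngle (κ.span i))) (κ.nextEnd i) := by
  obtain ⟨T, hT, rfl, rfl, rfl⟩ := h
  obtain ⟨S, hS, j, h1, h2⟩ := h𝒯.exists_across hT (i + 3)
  have hi : i + 3 + 1 = i := by omega
  refine ⟨S.kind, j, ⟨S, hS, rfl, by rw [h1, hi], ?_⟩, h𝒯.sideEnd_across hS hT h1 h2⟩
  have h3 := T.side_pred i
  rw [RhombTile.turn] at h3
  rw [h3, RhombTile.side, RhombTile.side, h1, h2]; ring

/-- Every edge at `u` is the end of a sector at `u`. -/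
lemma exists_sector_before {u d : ℂ} {a : EdgeEnd} (h : HasEdge 𝒯 u d a) :
    ∃ d' κ i, HasSector 𝒯 u d' κ i ∧ d' * cis (stepAngle (κ.span i)) = d ∧
      κ.nextEnd i = a := by
  obtain ⟨_, j, ⟨T, hT, rfl, rfl, rfl⟩, rfl⟩ := h
  obtain ⟨S, hS, k, h1, h2⟩ := h𝒯.exists_across hT j
  have hk : k + 1 + 3 = k := by omega
  refine ⟨S.side (k + 1), S.kind, k + 1, ⟨S, hS, rfl, h2, rfl⟩, ?_, ?_⟩
  · have h3 := S.side_pred (k + 1)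
    rw [RhombTile.turn, hk] at h3
    rw [h3, RhombTile.side, RhombTile.side, h1, h2]; ring
  · rw [RhombKind.nextEnd, hk, h𝒯.sideEnd_across hS hT h1 h2, EdgeEnd.reverse_reverse]

/-- The edge seen from its other vertex. -/
lemma hasEdge_reverse {u d : ℂ} {a : EdgeEnd} (h : HasEdge 𝒯 u d a) :
    HasEdge 𝒯 (u + d) (-d) a.reverse := by
  obtain ⟨_, j, ⟨T, hT, rfl, rfl, rfl⟩, rfl⟩ := h
  obtain ⟨S, hS, k, h1, h2⟩ := h𝒯.exists_across hT j
  refine ⟨S.kind, k, ⟨S, hS, rfl, by rw [h1, T.corner_succ], ?_⟩, h𝒯.sideEnd_across hS hT h1 h2⟩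
  rw [RhombTile.side, RhombTile.side, h1, h2]; ring

/-- No edge at `u` points strictly inside a sector at `u`. -/
lemma sector_unique {u d : ℂ} {κ κ' : RhombKind} {i i' : Fin 4} {φ : ℝ}
    (h : HasSector 𝒯 u d κ i) (h' : HasSector 𝒯 u (d * cis φ) κ' i')
    (h0 : 0 ≤ φ) (h1 : φ < stepAngle (κ.span i)) : κ = κ' ∧ i = i' ∧ φ = 0 := by
  obtain ⟨S, hS, rfl, rfl, rfl⟩ := h
  obtain ⟨T, hT, rfl, hc, hd⟩ := h'
  obtain ⟨rfl, rfl, h⟩ := h𝒯.eq_of_overlap hS hT hc hd h0 h1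
  exact ⟨rfl, rfl, h⟩

lemma hasEdge_unique {u d : ℂ} {a b : EdgeEnd} (ha : HasEdge 𝒯 u d a) (hb : HasEdge 𝒯 u d b) :
    a = b := by
  obtain ⟨κ, i, h, rfl⟩ := ha
  obtain ⟨κ', i', h', rfl⟩ := hb
  obtain ⟨rfl, rfl, -⟩ := h𝒯.sector_unique (φ := 0) h (by simpa using h') le_rfl
    (κ.stepAngle_span_pos i)
  rfl

end IsPenroseRhombTiling

/-! ### Walks round a vertex -/

/-- `SectorWalk a c n w`: consecutive sectors lead counterclockwise from an edge with end `a` to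
an edge with end `c`; their angles add up to `n` times `π / 5`, and the labels of the edges at
which these sectors start add up to `w`. -/
inductive SectorWalk : EdgeEnd → EdgeEnd → ℕ → ℕ → Prop
  | nil (a : EdgeEnd) : SectorWalk a a 0 0
  | cons (κ : RhombKind) (i : Fin 4) {c : EdgeEnd} {n w : ℕ} :
      SectorWalk (κ.nextEnd i) c n w →
        SectorWalk (κ.sideEnd i) c (κ.span i + n) ((κ.sideEnd i).weight + w)

/-- The possible values of `w` in `SectorWalk a c n w`, for walks of at most `fuel` sectors. -/
def walkWeights (c : EdgeEnd) : ℕ → EdgeEnd → ℕ → List ℕ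
  | 0, a, n => if a = c ∧ n = 0 then [0] else []
  | fuel + 1, a, n => (if a = c ∧ n = 0 then [0] else []) ++
      ([.thick, .thin] : List RhombKind).flatMap fun κ =>
        ([0, 1, 2, 3] : List (Fin 4)).flatMap fun i =>
          if κ.sideEnd i = a ∧ κ.span i ≤ n then
            (walkWeights c fuel (κ.nextEnd i) (n - κ.span i)).map (a.weight + ·)
          else []

lemma SectorWalk.mem_walkWeights {a c : EdgeEnd} {n w : ℕ} (h : SectorWalk a c n w) (fuel : ℕ)
    (hf : n ≤ fuel) : w ∈ walkWeights c fuel a n := by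
  induction h generalizing fuel with
  | nil a => cases fuel <;> simp [walkWeights]
  | @cons κ i c n w _ ih =>
    have hpos := κ.span_pos i
    obtain ⟨f, rfl⟩ : ∃ f, fuel = f + 1 := ⟨fuel - 1, by omega⟩
    rw [walkWeights, List.mem_append, List.mem_flatMap]
    refine .inr ⟨κ, by cases κ <;> simp, ?_⟩
    rw [List.mem_flatMap]
    refine ⟨i, by fin_cases i <;> simp, ?_⟩
    rw [if_pos ⟨rfl, by omega⟩, List.mem_map]
    exact ⟨w, by rw [Nat.add_sub_cancel_left]; exact ih f (by omega), rfl⟩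

lemma SectorWalk.weight_doubleIn {w : ℕ} (h : SectorWalk .doubleIn .doubleIn 10 w) : w ≤ 5 :=
  (by decide : ∀ w ∈ walkWeights .doubleIn 10 .doubleIn 10, w ≤ 5) _ (h.mem_walkWeights _ le_rfl)

lemma SectorWalk.weight_doubleOut {w : ℕ} (h : SectorWalk .doubleOut .doubleOut 10 w) : 7 ≤ w :=
  (by decide : ∀ w ∈ walkWeights .doubleOut 10 .doubleOut 10, 7 ≤ w) _ (h.mem_walkWeights _ le_rfl)

lemma SectorWalk.weight_singleOut {w : ℕ} (h : SectorWalk .singleOut .singleOut 10 w) : 11 ≤ w :=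
  (by decide : ∀ w ∈ walkWeights .singleOut 10 .singleOut 10, 11 ≤ w) _ (h.mem_walkWeights _ le_rfl)

lemma SectorWalk.weight_singleIn {w : ℕ} (h : SectorWalk .singleIn .singleIn 10 w) : w ≤ 12 :=
  (by decide : ∀ w ∈ walkWeights .singleIn 10 .singleIn 10, w ≤ 12) _ (h.mem_walkWeights _ le_rfl)

/-- The remaining sectors at a vertex with an angle between two incoming single arrows. -/
lemma SectorWalk.weight_singleIn_six {w : ℕ} (h : SectorWalk .singleIn .singleIn 6 w) : w = 4 :=
  (by decide : ∀ w ∈ walkWeights .singleIn 6 .singleIn 6, w = 4) _ (h.mem_walkWeights _ le_rfl)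

/-- The remaining sectors at a vertex with three consecutive outgoing single arrows. -/
lemma SectorWalk.weight_singleOut_six {w : ℕ} (h : SectorWalk .singleOut .singleOut 6 w) : 9 ≤ w :=
  (by decide : ∀ w ∈ walkWeights .singleOut 6 .singleOut 6, 9 ≤ w) _ (h.mem_walkWeights _ le_rfl)

/-! ### The weighted degree as the weight of a closed walk -/

open Classical in
/-- The label of the edge at `u` in direction `d`, and `0` if there is no such edge. -/
noncomputable def labelAt (𝒯 : Set RhombTile) (u d : ℂ) : ℕ :=
  if h : ∃ a, HasEdge 𝒯 u d a then h.choose.weight else 0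

open Classical in
/-- The edge labelling: `3` on single and `1` on double arrows. -/
noncomputable def arrowLabel (𝒯 : Set RhombTile) (e : (tilingGraph 𝒯).edgeSet) : ℕ :=
  if CarriesArrow 𝒯 .single e then 3 else 1

lemma HasEdge.norm_eq_one {𝒯 : Set RhombTile} {u d : ℂ} {a : EdgeEnd} (h : HasEdge 𝒯 u d a) :
    ‖d‖ = 1 := by
  obtain ⟨κ, i, ⟨T, -, -, -, rfl⟩, -⟩ := h
  exact T.norm_side i

lemma HasEdge.ne_zero {𝒯 : Set RhombTile} {u d : ℂ} {a : EdgeEnd} (h : HasEdge 𝒯 u d a) :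
    d ≠ 0 := by
  rintro rfl
  simpa using h.norm_eq_one

lemma HasEdge.mem_tilingVertices {𝒯 : Set RhombTile} {u d : ℂ} {a : EdgeEnd}
    (h : HasEdge 𝒯 u d a) : u + d ∈ tilingVertices 𝒯 := by
  obtain ⟨κ, i, ⟨T, hT, -, rfl, rfl⟩, -⟩ := h
  exact ⟨T, hT, i + 1, (T.corner_succ i).symm⟩

lemma exists_hasEdge {𝒯 : Set RhombTile} (u : tilingVertices 𝒯) : ∃ d a, HasEdge 𝒯 u d a := by
  obtain ⟨_, T, hT, i, rfl⟩ := u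
  exact ⟨T.side i, _, T.kind, i, ⟨T, hT, rfl, rfl, rfl⟩, rfl⟩

lemma hasEdge_rotate_ten {𝒯 : Set RhombTile} {u d : ℂ} {a : EdgeEnd} :
    HasEdge 𝒯 u (d * cis (stepAngle 10)) a ↔ HasEdge 𝒯 u d a := by
  rw [cis_stepAngle_ten, mul_one]

lemma rotate_add (d : ℂ) (m n : ℕ) :
    d * cis (stepAngle (m + n)) = d * cis (stepAngle m) * cis (stepAngle n) := by
  rw [stepAngle_add, cis_add, mul_assoc]

lemma rotate_injective {d : ℂ} (hd : d ≠ 0) {m n : ℕ} (hm : m < 10) (hn : n < 10)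
    (h : d * cis (stepAngle m) = d * cis (stepAngle n)) : m = n := by
  wlog hmn : m ≤ n generalizing m n
  · exact (this hn hm h.symm (by omega)).symm
  obtain ⟨k, rfl⟩ := Nat.exists_eq_add_of_le hmn
  have hne : d * cis (stepAngle m) ≠ 0 :=
    mul_ne_zero hd (norm_ne_zero_iff.1 (by rw [norm_cis]; exact one_ne_zero))
  have h1 : cis (stepAngle k) = 1 := by
    rw [rotate_add] at h
    exact (mul_left_cancel₀ hne (by rw [mul_one]; exact h)).symm
  have h2 : stepAngle k < 2 * Real.pi := by rw [← stepAngle_ten, stepAngle_lt]; omega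
  have h3 := cis_eq_one (stepAngle_nonneg k) h2 h1
  rw [← stepAngle_zero] at h3
  have := stepAngle_le.1 h3.le
  omega

lemma exists_eq_mul_cis {d d' : ℂ} (hd : ‖d‖ = 1) (hd' : ‖d'‖ = 1) :
    ∃ φ, 0 ≤ φ ∧ φ < 2 * Real.pi ∧ d' = d * cis φ := by
  have hd0 : d ≠ 0 := norm_ne_zero_iff.1 (by rw [hd]; exact one_ne_zero)
  have h : cis (d' / d).arg = d' / d := by
    have := Complex.norm_mul_exp_arg_mul_I (d' / d)
    rwa [norm_div, hd, hd', div_one, Complex.ofReal_one, one_mul] at this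
  have hpi := Real.pi_pos
  have h2 := Complex.neg_pi_lt_arg (d' / d)
  have h3 := Complex.arg_le_pi (d' / d)
  rcases le_or_gt 0 (d' / d).arg with h0 | h0
  · exact ⟨_, h0, by linarith, by rw [h, mul_div_cancel₀ _ hd0]⟩
  · refine ⟨(d' / d).arg + 2 * Real.pi, by linarith, by linarith, ?_⟩
    rw [cis_add, h, ← stepAngle_ten, cis_stepAngle_ten, mul_one, mul_div_cancel₀ _ hd0]

namespace IsPenroseRhombTiling

variable {𝒯 : Set RhombTile} (h𝒯 : IsPenroseRhombTiling 𝒯)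
include h𝒯

lemma labelAt_eq {u d : ℂ} {a : EdgeEnd} (h : HasEdge 𝒯 u d a) : labelAt 𝒯 u d = a.weight := by
  have h' : ∃ a, HasEdge 𝒯 u d a := ⟨a, h⟩
  rw [labelAt, dif_pos h', h𝒯.hasEdge_unique h'.choose_spec h]

lemma hasEdge_of_mem_arrows {T : RhombTile} (hT : T ∈ 𝒯) {k : ArrowKind} {u v : ℂ}
    (h : (u, v) ∈ T.arrows k) : HasEdge 𝒯 u (v - u) (EdgeEnd.tail k) := by
  obtain ⟨i, ⟨rfl, rfl⟩ | ⟨rfl, rfl⟩⟩ := T.isSide_of_mem_arrows h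
  · exact ⟨_, i, ⟨T, hT, rfl, rfl, rfl⟩, (T.mem_arrows_side_iff i k).1 h⟩
  · have h1 : HasEdge 𝒯 (T.corner i) (T.side i) (T.kind.sideEnd i) :=
      ⟨_, i, ⟨T, hT, rfl, rfl, rfl⟩, rfl⟩
    have h2 := h𝒯.hasEdge_reverse h1
    rw [(T.mem_arrows_reversed_side_iff i k).1 h, ← T.corner_succ] at h2
    simpa [RhombTile.side] using h2

lemma adj_iff {u v : tilingVertices 𝒯} :
    (tilingGraph 𝒯).Adj u v ↔ ∃ a, HasEdge 𝒯 u (v - u) a := by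
  constructor
  · rintro ⟨-, T, hT, i, ⟨hu, hv⟩ | ⟨hv, hu⟩⟩
    · exact ⟨_, _, i, ⟨T, hT, rfl, hu.symm, by rw [RhombTile.side, hu, hv]⟩, rfl⟩
    · have h1 : HasEdge 𝒯 (T.corner i) (T.side i) (T.kind.sideEnd i) :=
        ⟨_, i, ⟨T, hT, rfl, rfl, rfl⟩, rfl⟩
      have h2 := h𝒯.hasEdge_reverse h1
      rw [← T.corner_succ] at h2
      exact ⟨_, by simpa [RhombTile.side, hu, hv] using h2⟩
  · rintro ⟨a, h⟩
    refine ⟨fun huv => h.ne_zero (by rw [huv, sub_self]), ?_⟩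
    obtain ⟨_, i, ⟨T, hT, -, h1, h2⟩, -⟩ := h
    exact ⟨T, hT, i, .inl ⟨h1.symm, by rw [T.corner_succ, h1, h2]; ring⟩⟩

lemma carriesArrow_iff {u v : tilingVertices 𝒯} (huv : s(u, v) ∈ (tilingGraph 𝒯).edgeSet)
    {a : EdgeEnd} (h : HasEdge 𝒯 u (v - u) a) (k : ArrowKind) :
    CarriesArrow 𝒯 k ⟨s(u, v), huv⟩ ↔ a = EdgeEnd.tail k ∨ a.reverse = EdgeEnd.tail k := by
  have hrev : ∀ {u v : ℂ} {a : EdgeEnd}, HasEdge 𝒯 u (v - u) a → HasEdge 𝒯 v (u - v) a.reverse :=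
    fun h => by simpa using h𝒯.hasEdge_reverse h
  constructor
  · rintro ⟨T, hT, p, q, hpq, he⟩
    have h1 := h𝒯.hasEdge_of_mem_arrows hT hpq
    rcases Sym2.eq_iff.1 he with ⟨rfl, rfl⟩ | ⟨rfl, rfl⟩
    · exact .inl (h𝒯.hasEdge_unique h h1)
    · exact .inr (h𝒯.hasEdge_unique (hrev h) h1)
  · rintro (rfl | ha)
    · obtain ⟨_, i, ⟨T, hT, rfl, h1, h2⟩, h3⟩ := h
      refine ⟨T, hT, u, v, ?_, rfl⟩
      rw [← T.mem_arrows_side_iff, T.corner_succ, h1, h2] at h3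
      simpa using h3
    · obtain ⟨_, i, ⟨T, hT, rfl, h1, h2⟩, h3⟩ := ha ▸ hrev h
      refine ⟨T, hT, v, u, ?_, Sym2.eq_swap⟩
      rw [← T.mem_arrows_side_iff, T.corner_succ, h1, h2] at h3
      simpa using h3

lemma arrowLabel_eq {u v : tilingVertices 𝒯} (huv : s(u, v) ∈ (tilingGraph 𝒯).edgeSet)
    {a : EdgeEnd} (h : HasEdge 𝒯 u (v - u) a) : arrowLabel 𝒯 ⟨s(u, v), huv⟩ = a.weight := by
  rw [arrowLabel, h𝒯.carriesArrow_iff huv h]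
  cases a <;> simp [EdgeEnd.tail, EdgeEnd.reverse, EdgeEnd.weight]

/-- All edges at a vertex make angles with each other that are multiples of `π / 5`. -/
lemma exists_eq_rotate {u d d' : ℂ} {a a' : EdgeEnd} (h : HasEdge 𝒯 u d a)
    (h' : HasEdge 𝒯 u d' a') : ∃ m < 10, d' = d * cis (stepAngle m) := by
  obtain ⟨φ, hφ0, hφ1, rfl⟩ := exists_eq_mul_cis h.norm_eq_one h'.norm_eq_one
  -- Step from sector to sector until the one that contains the direction is reached.
  have key : ∀ r m, m + r = 10 → stepAngle m ≤ φ → (∃ b, HasEdge 𝒯 u (d * cis (stepAngle m)) b) →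
      ∃ m < 10, φ = stepAngle m := by
    intro r
    induction r using Nat.strong_induction_on with
    | _ r ih =>
      rintro m hmr hm ⟨b, κ, i, hs, -⟩
      rcases lt_or_ge φ (stepAngle (m + κ.span i)) with hlt | hge
      · obtain ⟨κ', i', hs', -⟩ := h'
        rw [stepAngle_add] at hlt
        have e : d * cis φ = d * cis (stepAngle m) * cis (φ - stepAngle m) := by
          rw [mul_assoc, ← cis_add]; congr 2; ring
        rw [e] at hs'
        have h0 := (h𝒯.sector_unique hs hs' (by linarith) (by linarith)).2.2
        have h1 : φ = stepAngle m := by linarith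
        refine ⟨m, ?_, h1⟩
        rw [← stepAngle_lt, stepAngle_ten, ← h1]; exact hφ1
      · have hlt : m + κ.span i < 10 := by
          rw [← stepAngle_lt, stepAngle_ten]; exact hge.trans_lt hφ1
        have hpos := κ.span_pos i
        exact ih (r - κ.span i) (by omega) (m + κ.span i) (by omega) hge
          ⟨_, by rw [rotate_add]; exact h𝒯.hasEdge_end hs⟩
  obtain ⟨m, hm, rfl⟩ := key 10 0 rfl (by simpa using hφ0) ⟨a, by simpa using h⟩
  exact ⟨m, hm, rfl⟩

lemma exists_bijective_neighborSet (u : tilingVertices 𝒯) {d : ℂ} {a : EdgeEnd}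
    (h : HasEdge 𝒯 u d a) :
    ∃ e : {j : Fin 10 // ∃ b, HasEdge 𝒯 u (d * cis (stepAngle j)) b} →
      (tilingGraph 𝒯).neighborSet u, Function.Bijective e ∧
      ∀ j, (((e j : tilingVertices 𝒯) : ℂ) - u) = d * cis (stepAngle j) := by
  refine ⟨fun j => ⟨⟨u + d * cis (stepAngle j), j.2.choose_spec.mem_tilingVertices⟩,
    h𝒯.adj_iff.2 ?_⟩, ⟨?_, ?_⟩, fun j => by simp⟩
  · obtain ⟨b, hb⟩ := j.2
    exact ⟨b, by simpa using hb⟩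
  · rintro ⟨j, hj⟩ ⟨k, hk⟩ hjk
    have hjk' : (u : ℂ) + d * cis (stepAngle j) = u + d * cis (stepAngle k) :=
      congrArg (fun v : (tilingGraph 𝒯).neighborSet u => ((v : tilingVertices 𝒯) : ℂ)) hjk
    exact Subtype.ext (Fin.ext (rotate_injective h.ne_zero j.2 k.2 (add_left_cancel hjk')))
  · rintro ⟨v, hv⟩
    obtain ⟨b, hb⟩ := h𝒯.adj_iff.1 hv
    obtain ⟨m, hm, hmd⟩ := h𝒯.exists_eq_rotate h hb
    refine ⟨⟨⟨m, hm⟩, b, by simpa [← hmd] using hb⟩, ?_⟩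
    apply Subtype.ext
    apply Subtype.ext
    simp [← hmd]

lemma finite_neighborSet (u : tilingVertices 𝒯) : ((tilingGraph 𝒯).neighborSet u).Finite := by
  obtain ⟨d, a, h⟩ := exists_hasEdge u
  obtain ⟨e, he, -⟩ := h𝒯.exists_bijective_neighborSet u h
  exact Set.finite_coe_iff.1 (Finite.of_surjective e he.2)

lemma weightedDegree_eq_sum (u : tilingVertices 𝒯) {d : ℂ} {a : EdgeEnd} (h : HasEdge 𝒯 u d a) :
    weightedDegree (tilingGraph 𝒯) (arrowLabel 𝒯) u =
      ∑ j ∈ Finset.range 10, labelAt 𝒯 u (d * cis (stepAngle j)) := by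
  classical
  obtain ⟨e, he, hed⟩ := h𝒯.exists_bijective_neighborSet u h
  rw [weightedDegree, ← finsum_eq_of_bijective (f := fun j : {j : Fin 10 //
    ∃ b, HasEdge 𝒯 u (d * cis (stepAngle j)) b} => labelAt 𝒯 u (d * cis (stepAngle j))) e he,
    finsum_eq_sum_of_fintype, ← Fin.sum_univ_eq_sum_range (fun j => labelAt 𝒯 u
      (d * cis (stepAngle j)))]
  · rw [← Finset.sum_subtype (Finset.univ.filter fun j : Fin 10 =>
      ∃ b, HasEdge 𝒯 u (d * cis (stepAngle j)) b) (by simp)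
      (fun j => labelAt 𝒯 u (d * cis (stepAngle j)))]
    exact Finset.sum_filter_of_ne fun j _ hj => by_contra fun hn => hj (dif_neg hn)
  · intro j
    obtain ⟨b, hb⟩ := j.2
    rw [h𝒯.labelAt_eq hb]
    exact (h𝒯.arrowLabel_eq _ (by rw [hed]; exact hb)).symm

/-- The labels of the edges in the directions from the start of a sector until just before its
end add up to the label at its start, as no edge lies inside the sector. -/
lemma sum_labelAt_sector {u d : ℂ} {m : ℕ} {κ : RhombKind} {i : Fin 4}
    (h : HasSector 𝒯 u (d * cis (stepAngle m)) κ i) :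
    ∑ j ∈ Finset.Ico m (m + κ.span i), labelAt 𝒯 u (d * cis (stepAngle j)) =
      (κ.sideEnd i).weight := by
  have hpos := κ.span_pos i
  rw [Finset.sum_eq_single_of_mem m (Finset.mem_Ico.2 ⟨le_rfl, by omega⟩)]
  · exact h𝒯.labelAt_eq ⟨κ, i, h, rfl⟩
  · intro j hj hjm
    rw [Finset.mem_Ico] at hj
    obtain ⟨k, rfl⟩ := Nat.exists_eq_add_of_le hj.1
    refine dif_neg ?_
    rintro ⟨b, κ', i', h', -⟩
    rw [rotate_add] at h'
    have h0 := (h𝒯.sector_unique h h' (stepAngle_nonneg k) (stepAngle_lt.2 (by omega))).2.2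
    rw [← stepAngle_zero] at h0
    have := stepAngle_le.1 h0.le
    omega

/-- Going round a vertex from any edge there leads back to the starting edge after a full turn. -/
lemma sectorWalk {u d : ℂ} {c : EdgeEnd} (h : HasEdge 𝒯 u d c) {m : ℕ} (hm : m ≤ 10)
    {a : EdgeEnd} (ha : HasEdge 𝒯 u (d * cis (stepAngle m)) a) :
    SectorWalk a c (10 - m) (∑ j ∈ Finset.Ico m 10, labelAt 𝒯 u (d * cis (stepAngle j))) := by
  obtain ⟨r, hr⟩ : ∃ r, r = 10 - m := ⟨_, rfl⟩
  induction r using Nat.strong_induction_on generalizing m a with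
  | _ r ih =>
    rcases hm.eq_or_lt with rfl | hlt
    · obtain rfl := h𝒯.hasEdge_unique (hasEdge_rotate_ten.1 ha) h
      simpa using SectorWalk.nil a
    · obtain ⟨κ, i, hs, rfl⟩ := ha
      have hpos := κ.span_pos i
      -- The sector cannot reach beyond the starting edge.
      have hle : m + κ.span i ≤ 10 := by
        by_contra hgt
        obtain ⟨κ', i', hs', -⟩ := hasEdge_rotate_ten.2 h
        rw [show 10 = m + (10 - m) by omega, rotate_add] at hs'
        have h0 := (h𝒯.sector_unique hs hs' (stepAngle_nonneg _) (stepAngle_lt.2 (by omega))).2.2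
        rw [← stepAngle_zero] at h0
        have := stepAngle_le.1 h0.le
        omega
      have hn := ih (10 - (m + κ.span i)) (by omega) hle
        (by rw [rotate_add]; exact h𝒯.hasEdge_end hs) rfl
      rw [← Finset.sum_Ico_consecutive _ (Nat.le_add_right m _) hle, h𝒯.sum_labelAt_sector hs,
        show 10 - m = κ.span i + (10 - (m + κ.span i)) by omega]
      exact .cons κ i hn

lemma sectorWalk_weightedDegree (u : tilingVertices 𝒯) {d : ℂ} {a : EdgeEnd}
    (h : HasEdge 𝒯 u d a) :
    SectorWalk a a 10 (weightedDegree (tilingGraph 𝒯) (arrowLabel 𝒯) u) := by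
  rw [h𝒯.weightedDegree_eq_sum u h, Finset.range_eq_Ico]
  exact h𝒯.sectorWalk h (Nat.zero_le _) (by simpa using h)

/-! ### Adjacent vertices have different weighted degrees -/

/-- A vertex at the corner `B` of a thin rhomb has three edges, of labels `3`, `3` and `1`. -/
lemma weightedDegree_of_thin_corner (u : tilingVertices 𝒯) {d : ℂ}
    (h : HasSector 𝒯 u d .thin 1) :
    weightedDegree (tilingGraph 𝒯) (arrowLabel 𝒯) u = 7 := by
  have he : HasEdge 𝒯 u d .singleIn := ⟨_, _, h, rfl⟩
  have h1 := h𝒯.sum_labelAt_sector (m := 0) (by simpa using h)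
  have h2 : HasEdge 𝒯 u (d * cis (stepAngle 4)) .singleIn := by
    have := h𝒯.hasEdge_end h
    rwa [show RhombKind.thin.span 1 = 4 from rfl] at this
  have h3 := (h𝒯.sectorWalk he (m := 4) (by norm_num) h2).weight_singleIn_six
  rw [h𝒯.weightedDegree_eq_sum u he, Finset.range_eq_Ico,
    ← Finset.sum_Ico_consecutive _ (show 0 ≤ 4 by norm_num) (show 4 ≤ 10 by norm_num), h3]
  simp only [RhombKind.span, RhombKind.sideEnd, EdgeEnd.weight, Matrix.cons_val_one,
    Matrix.cons_val_zero, zero_add] at h1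
  rw [h1]

/-- A vertex with two consecutive corners `A` of thick rhombs has three consecutive outgoing
single arrows. -/
lemma le_weightedDegree_of_thick_corners (u : tilingVertices 𝒯) {d : ℂ}
    (h : HasSector 𝒯 u d .thick 0) (h' : HasSector 𝒯 u (d * cis (stepAngle 2)) .thick 0) :
    15 ≤ weightedDegree (tilingGraph 𝒯) (arrowLabel 𝒯) u := by
  have he : HasEdge 𝒯 u d .singleOut := ⟨_, _, h, rfl⟩
  have h1 := h𝒯.sum_labelAt_sector (m := 0) (by simpa using h)
  have h1' := h𝒯.sum_labelAt_sector (m := 2) h'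
  have h2 : HasEdge 𝒯 u (d * cis (stepAngle 4)) .singleOut := by
    have := h𝒯.hasEdge_end h'
    rwa [show RhombKind.thick.span 0 = 2 from rfl, ← rotate_add] at this
  have h3 := (h𝒯.sectorWalk he (m := 4) (by norm_num) h2).weight_singleOut_six
  rw [h𝒯.weightedDegree_eq_sum u he, Finset.range_eq_Ico,
    ← Finset.sum_Ico_consecutive _ (show 0 ≤ 4 by norm_num) (show 4 ≤ 10 by norm_num),
    ← Finset.sum_Ico_consecutive _ (show 0 ≤ 2 by norm_num) (show 2 ≤ 4 by norm_num)]
  simp only [RhombKind.span, RhombKind.sideEnd, EdgeEnd.weight, Matrix.cons_val_zero, zero_add,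
    Nat.reduceAdd] at h1 h1'
  omega

/-- The two rhombs at an outgoing single arrow from `u` to `v`: if one of them is thin, then `v` is
its corner `B`; otherwise both are thick with corner `A` at `u`. -/
lemma weightedDegree_ne_of_single {u v : tilingVertices 𝒯}
    (h : HasEdge 𝒯 u (v - u) .singleOut) :
    weightedDegree (tilingGraph 𝒯) (arrowLabel 𝒯) u ≠
      weightedDegree (tilingGraph 𝒯) (arrowLabel 𝒯) v := by
  have hv : HasEdge 𝒯 v (u - v) .singleIn := by simpa [EdgeEnd.reverse] using h𝒯.hasEdge_reverse h
  have hv12 := (h𝒯.sectorWalk_weightedDegree v hv).weight_singleIn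
  have hu11 := (h𝒯.sectorWalk_weightedDegree u h).weight_singleOut
  obtain ⟨d, κ, i, hs, hd, hend⟩ := h𝒯.exists_sector_before h
  obtain ⟨κ', i', hs', hstart⟩ := h
  have c' : (κ' = .thin ∧ i' = 0) ∨ (κ' = .thick ∧ i' = 0) := by
    cases κ' <;> fin_cases i' <;> simp [RhombKind.sideEnd] at hstart ⊢
  have c : (κ = .thin ∧ i = 2) ∨ (κ = .thick ∧ i = 0) := by
    cases κ <;> fin_cases i <;>
      simp [RhombKind.nextEnd, RhombKind.sideEnd, EdgeEnd.reverse] at hend ⊢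
  rcases c' with ⟨rfl, rfl⟩ | ⟨rfl, rfl⟩
  · obtain ⟨T, hT, hκ, hc, hside⟩ := hs'
    have := h𝒯.weightedDegree_of_thin_corner v (d := T.side 1)
      ⟨T, hT, hκ, by have := T.corner_succ 0; rw [hc, hside] at this; simpa using this, rfl⟩
    omega
  rcases c with ⟨rfl, rfl⟩ | ⟨rfl, rfl⟩
  · obtain ⟨T, hT, hκ, hc, hside⟩ := hs
    have := h𝒯.weightedDegree_of_thin_corner v (d := T.side 1) ⟨T, hT, hκ, ?_, rfl⟩
    · omega
    · have h1 := T.corner_pred 2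
      rw [RhombTile.turn, hκ, hc, hside, hd] at h1
      simpa using h1
  · rw [← hd] at hs'
    have := h𝒯.le_weightedDegree_of_thick_corners u hs hs'
    omega

/-- All edges at the head of a double arrow are double and there are at most five of them, while
the tail of a double arrow has weighted degree at least `7`. -/
lemma weightedDegree_ne_of_double {u v : tilingVertices 𝒯}
    (h : HasEdge 𝒯 u (v - u) .doubleOut) :
    weightedDegree (tilingGraph 𝒯) (arrowLabel 𝒯) u ≠
      weightedDegree (tilingGraph 𝒯) (arrowLabel 𝒯) v := by
  have hv : HasEdge 𝒯 v (u - v) .doubleIn := by simpa [EdgeEnd.reverse] using h𝒯.hasEdge_reverse h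
  have h1 := (h𝒯.sectorWalk_weightedDegree v hv).weight_doubleIn
  have h2 := (h𝒯.sectorWalk_weightedDegree u h).weight_doubleOut
  omega

lemma weightedDegree_ne {u v : tilingVertices 𝒯} (huv : (tilingGraph 𝒯).Adj u v) :
    weightedDegree (tilingGraph 𝒯) (arrowLabel 𝒯) u ≠
      weightedDegree (tilingGraph 𝒯) (arrowLabel 𝒯) v := by
  obtain ⟨a, h⟩ := h𝒯.adj_iff.1 huv
  have h' : HasEdge 𝒯 v (u - v) a.reverse := by simpa using h𝒯.hasEdge_reverse h
  cases a with
  | singleOut => exact h𝒯.weightedDegree_ne_of_single h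
  | singleIn => exact (h𝒯.weightedDegree_ne_of_single h').symm
  | doubleOut => exact h𝒯.weightedDegree_ne_of_double h
  | doubleIn => exact (h𝒯.weightedDegree_ne_of_double h').symm

end IsPenroseRhombTiling

theorem mainTheorem2 (𝒯 : Set RhombTile) (h𝒯 : IsPenroseRhombTiling 𝒯) :
    ∃ l : (tilingGraph 𝒯).edgeSet → ℕ,
      (∀ e, CarriesArrow 𝒯 ArrowKind.double e → l e = 1) ∧
      (∀ e, CarriesArrow 𝒯 ArrowKind.single e → l e = 3) ∧
      IsOneTwoThreeSolution (tilingGraph 𝒯) l := by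
  refine ⟨arrowLabel 𝒯, ?_, fun e he => if_pos he, h𝒯.finite_neighborSet, fun e => ?_,
    fun u v huv => h𝒯.weightedDegree_ne huv⟩
  · rintro ⟨e, he⟩ hd
    induction e using Sym2.ind with
    | _ u v =>
      obtain ⟨a, h⟩ := h𝒯.adj_iff.1 he
      rw [h𝒯.carriesArrow_iff he h] at hd
      rw [h𝒯.arrowLabel_eq he h]
      revert hd
      cases a <;> simp [EdgeEnd.tail, EdgeEnd.reverse, EdgeEnd.weight]
  · unfold arrowLabel
    split <;> simp
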